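/- All groups are finite. Let $G$ be a finite group, let $F(G)$ be its Fitting subgroup (the largest nilpotent normal subgroup), and let $F^*(G)$ be its quasinilpotent radical, i.e. the subgroup of $G$ containing $F(G)$ that is determined by $F^*(G)/F(G)=\mathrm{Soc}\bigl(C_G(F(G))F(G)/F(G)\bigr)$, where the socle $\mathrm{Soc}(X)$ of a group $X$ is the product of all minimal normal subgroups of $X$. A subgroup $H$ of $G$ is called $F^*(G)$-subnormal if $H$ is subnormal in $\langle H,F^*(G)\rangle$; it is called abnormal in $G$ if $g\in\langle H,H^g\rangle$ for all $g\in G$, where $H^g=g^{-1}Hg$. A subgroup is called primary if its order is a power of a prime. Theorem 4.3. The following statements are equivalent: (1) $G$ is nilpotent; (2) every abnormal subgroup of $G$ is $F^*(G)$-subnormal; (3) the normalizer in $G$ of every Sylow subgroup of $G$ is $F^*(G)$-subnormal; (4) every cyclic primary subgroup of $G$ is $F^*(G)$-subnormal; (5) every Sylow subgroup of $G$ is $F^*(G)$-subnormal. -/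

import Mathlib

namespace FiniteGroupTheory

/-- The Fitting subgroup `F(G)`: the product of all nilpotent normal subgroups of `G`
(for finite `G`, the largest nilpotent normal subgroup). -/
def fittingSubgroup (G : Type*) [Group G] : Subgroup G :=
  sSup {N : Subgroup G | N.Normal ∧ Group.IsNilpotent N}

instance fittingSubgroup_normal (G : Type*) [Group G] : (fittingSubgroup G).Normal := by
  refine ⟨fun n hn g => ?_⟩
  have key : fittingSubgroup G ≤ (fittingSubgroup G).comap (MulAut.conj g).toMonoidHom := by
    refine sSup_le fun N hN x hx => ?_
    have hle : N ≤ fittingSubgroup G := le_sSup hN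
    exact hle (hN.1.conj_mem x hx g)
  exact key hn

/-- `N` is a minimal normal subgroup of `G`: a nontrivial normal subgroup that contains no
normal subgroups of `G` other than the trivial one and itself. -/
def IsMinimalNormal {G : Type*} [Group G] (N : Subgroup G) : Prop :=
  N.Normal ∧ N ≠ ⊥ ∧ ∀ K : Subgroup G, K.Normal → K ≤ N → K = ⊥ ∨ K = N

/-- The socle `Soc(G)`: the product of all minimal normal subgroups of `G`. -/
def socle (G : Type*) [Group G] : Subgroup G :=
  sSup {N : Subgroup G | IsMinimalNormal N}

/-- The subgroup `C_G(F(G)) F(G) / F(G)` of `G / F(G)`. -/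
def fittingCentralizerQuotient (G : Type*) [Group G] : Subgroup (G ⧸ fittingSubgroup G) :=
  (Subgroup.centralizer (fittingSubgroup G : Set G) ⊔ fittingSubgroup G).map
    (QuotientGroup.mk' (fittingSubgroup G))

/-- The quasinilpotent radical `F^*(G)`, given by
`F^*(G) / F(G) = Soc(C_G(F(G)) F(G) / F(G))`: it is the full preimage in `G` of the socle of
the group `C_G(F(G)) F(G) / F(G)`, seen inside `G / F(G)`. -/
def quasinilpotentRadical (G : Type*) [Group G] : Subgroup G :=
  ((socle (fittingCentralizerQuotient G)).map (fittingCentralizerQuotient G).subtype).comap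
    (QuotientGroup.mk' (fittingSubgroup G))

/-- `H` is `R`-subnormal: `H` is subnormal in the subgroup `⟨H, R⟩`. -/
def IsRelSubnormal {G : Type*} [Group G] (R H : Subgroup G) : Prop :=
  (H.subgroupOf (H ⊔ R)).IsSubnormal

/-- `H` is abnormal in `G`: `g ∈ ⟨H, H ^ g⟩` for all `g : G`, where `H ^ g = g⁻¹ H g`. -/
def IsAbnormal {G : Type*} [Group G] (H : Subgroup G) : Prop :=
  ∀ g : G, g ∈ H ⊔ H.map (MulAut.conj g⁻¹).toMonoidHom

end FiniteGroupTheory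

/-!
In a nilpotent group every subgroup is subnormal, which gives all the conditions. The normalizer of
a Sylow subgroup is abnormal, and a Sylow subgroup is normal in its normalizer; cyclic primary
subgroups are subnormal in the Sylow subgroups that contain them. So the weakest of the conditions
is the one on cyclic primary subgroups, and the content of the theorem is that it forces `G` to be
nilpotent.

Write `F = F(G)`, `R = F^*(G)`, and let `x` be a `p`-element, so that `⟨x⟩` is subnormal in
`L = ⟨x, R⟩`. A subnormal `p`-subgroup lies in the `p`-core (`le_pCore_of_isSubnormal`), so
`x ∈ O_p(L)`, and `[x, R]` lies in `O_p(L) ∩ R`, a subnormal `p`-subgroup of `G`; hence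
`[x, R] ≤ O_p(G)` (`commutator_mem_pCore`). Two consequences follow.

* Since `G` is generated by its elements of prime power order, `R / F` is central in `G / F`. Then
  `R ∩ C_G(F)` is nilpotent of class at most two, so `R = F`, the socle of `C_G(F) F / F` is
  trivial, and `C_G(F) ≤ F`
  (`centralizer_fittingSubgroup_le_of_commutator_mem_pCore`). No structure theory of
  quasinilpotent groups is needed.
* `x` centralizes `O_r(G)` for every prime `r ≠ p`, because `O_p(G) ∩ O_r(G) = 1`.

As `F` is the product of the subgroups `O_r(G)` (`fittingSubgroup_eq_iSup_pCore`), a commutator of a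
`p`-element with a `q`-element, `p ≠ q`, centralizes `F` and so lies in `F`. Therefore `P F` is
normal in `G` for every Sylow subgroup `P`. Moreover `P` is normal in `P F`, and the Frattini
argument shows that `P` is normal in `G` (`sylow_normal_of_mem_centralizer_pCore`).
-/

open Subgroup
open scoped commutatorElement

namespace FiniteGroupTheory

/-! ### The `p`-core -/

/-- The `p`-core `O_p(G)`: the product of all normal `p`-subgroups of `G`. -/
def pCore (p : ℕ) (G : Type*) [Group G] : Subgroup G :=
  sSup {N : Subgroup G | N.Normal ∧ IsPGroup p N}

section PCore

variable {G : Type*} [Group G] {p : ℕ}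

theorem isPGroup_pCore : IsPGroup p (pCore p G) :=
  Sylow.sSup_of_normal _ (fun _ h => h.2) fun _ h => h.1

theorem le_pCore {N : Subgroup G} (hN : N.Normal) (hp : IsPGroup p N) : N ≤ pCore p G :=
  le_sSup ⟨hN, hp⟩

instance pCore_characteristic : (pCore p G).Characteristic := by
  rw [characteristic_iff_map_le]
  intro φ
  refine map_le_iff_le_comap.mpr (sSup_le fun N hN => map_le_iff_le_comap.mp ?_)
  exact le_pCore (hN.1.map _ φ.surjective) (hN.2.map _)

/-- A subnormal `p`-subgroup is contained in the `p`-core. -/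
theorem le_pCore_of_isSubnormal [Finite G] {H : Subgroup G} (hH : H.IsSubnormal)
    (hp : IsPGroup p H) : H ≤ pCore p G := by
  induction hn : Nat.card G using Nat.strong_induction_on generalizing G with
  | _ n ih =>
    subst hn
    rcases hH.lt_normal with rfl | ⟨K, hK, hHK, hlt⟩
    · exact le_pCore inferInstance hp
    · have hcard : Nat.card K < Nat.card G := by
        refine lt_of_le_of_ne (card_le_card_group K) fun h => hlt.ne (eq_top_of_card_eq K h)
      have h1 : H.subgroupOf K ≤ pCore p K :=
        ih _ hcard hH.subgroupOf hp.comap_subtype rfl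
      have h2 : H ≤ (pCore p K).map K.subtype := by
        rw [← map_subgroupOf_eq_of_le hHK]
        exact map_mono h1
      exact h2.trans (le_pCore inferInstance (isPGroup_pCore.map _))

end PCore

section Finite

variable {G : Type*} [Group G]

/-! ### Sylow subgroups, subnormality and abnormality -/

/-- A finite group is generated by any choice of one Sylow subgroup for each prime. -/
theorem eq_top_of_forall_exists_sylow_le [Finite G] {K : Subgroup G}
    (h : ∀ p : ℕ, p.Prime → ∃ P : Sylow p G, (P : Subgroup G) ≤ K) : K = ⊤ := by
  rw [← index_eq_one]
  by_contra hne
  obtain ⟨p, hp, hdvd⟩ := Nat.exists_prime_and_dvd hne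
  obtain ⟨P, hP⟩ := h p hp
  have := Fact.mk hp
  exact P.not_dvd_index (hdvd.trans (index_dvd_of_le hP))

/-- In a group satisfying the normalizer condition, ascending through normalizers reaches the
whole group. -/
theorem isSubnormal_of_normalizerCondition [Finite G] (hG : NormalizerCondition G)
    (H : Subgroup G) : H.IsSubnormal := by
  induction H using WellFoundedGT.induction with
  | _ H ih =>
    rcases eq_or_ne H ⊤ with rfl | hne
    · exact .top
    · have hlt := hG H hne.lt_top
      exact .step H _ hlt.le (ih _ hlt) normal_in_normalizer

theorem isSubnormal_of_isNilpotent [Finite G] [Group.IsNilpotent G] (H : Subgroup G) :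
    H.IsSubnormal :=
  isSubnormal_of_normalizerCondition Group.normalizerCondition_of_isNilpotent H

/-- `R`-subnormality passes from `B` to the subnormal subgroups of `B`. -/
theorem IsRelSubnormal.of_isSubnormal_subgroupOf {R A B : Subgroup G} (hB : IsRelSubnormal R B)
    (hAB : A ≤ B) (hA : (A.subgroupOf B).IsSubnormal) : IsRelSubnormal R A := by
  have h1 : (A.subgroupOf (B ⊔ R)).IsSubnormal := by
    refine IsSubnormal.trans (K := B.subgroupOf (B ⊔ R)) (comap_mono hAB) ?_ hB
    exact hA.comap (subgroupOfEquivOfLe (le_sup_left : B ≤ B ⊔ R)).toMonoidHom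
  exact h1.comap (inclusion (sup_le_sup_right hAB R))

/-- The normalizer of a Sylow subgroup is abnormal. -/
theorem isAbnormal_normalizer_sylow [Finite G] {p : ℕ} [Fact p.Prime] (P : Sylow p G) :
    IsAbnormal (normalizer (P : Set G)) := by
  intro g
  set J := normalizer (P : Set G) ⊔ (normalizer (P : Set G)).map (MulAut.conj g⁻¹).toMonoidHom
  have hP : (P : Subgroup G) ≤ J := le_normalizer.trans le_sup_left
  have hPg : ((g⁻¹ • P : Sylow p G) : Subgroup G) ≤ J :=
    (map_mono (le_normalizer (H := (P : Subgroup G)))).trans le_sup_right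
  -- By Sylow's theorem in `J`, some `j : J` conjugates `P` to `P ^ g`, so that `g * j` lies in
  -- the normalizer of `P`.
  obtain ⟨j, hj⟩ := MulAction.exists_smul_eq J (P.subtype hP) ((g⁻¹ • P).subtype hPg)
  have hj' : (j : G) • P = g⁻¹ • P :=
    Sylow.subtype_injective ((Sylow.smul_subtype hP j).symm.trans hj)
  have hmem : g * j ∈ normalizer (P : Set G) := by
    rw [← Sylow.smul_eq_iff_mem_normalizer, mul_smul, hj', smul_inv_smul]
  have := J.mul_mem (le_sup_left (a := normalizer (P : Set G)) hmem) (J.inv_mem j.2)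
  simpa using this

/-! ### The Fitting subgroup and the quasinilpotent radical -/

/-- The Fitting subgroup is the product of the `p`-cores, because a nilpotent normal subgroup is
the product of its Sylow subgroups, which are characteristic in it. -/
theorem fittingSubgroup_eq_iSup_pCore [Finite G] :
    fittingSubgroup G = ⨆ p : Nat.Primes, pCore p G := by
  apply le_antisymm
  · refine sSup_le fun N ⟨hN, hnil⟩ => ?_
    have key : (⨆ p : Nat.Primes, pCore p G).subgroupOf N = ⊤ := by
      refine eq_top_of_forall_exists_sylow_le fun p hp => ?_
      have := Fact.mk hp
      obtain ⟨P⟩ : Nonempty (Sylow p N) := inferInstance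
      refine ⟨P, map_le_iff_le_comap.mp (le_trans ?_ (le_iSup _ ⟨p, hp⟩))⟩
      have hPn : (P : Subgroup N).Normal :=
        (Group.isNilpotent_of_finite_tfae.out 0 3 rfl rfl).mp hnil p ‹_› P
      have := P.characteristic_of_normal hPn
      exact le_pCore inferInstance (P.isPGroup'.map _)
    exact subgroupOf_eq_top.mp key
  · refine iSup_le fun p => ?_
    have := Fact.mk p.2
    exact le_sSup ⟨inferInstance, isPGroup_pCore.isNilpotent⟩

theorem pCore_le_fittingSubgroup [Finite G] {p : ℕ} (hp : p.Prime) :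
    pCore p G ≤ fittingSubgroup G := by
  rw [fittingSubgroup_eq_iSup_pCore]
  exact le_iSup (fun p : Nat.Primes => pCore p G) ⟨p, hp⟩

theorem socle_characteristic : (socle G).Characteristic := by
  rw [characteristic_iff_map_le]
  intro φ
  refine map_le_iff_le_comap.mpr (sSup_le fun N ⟨hN, hne, hmin⟩ => map_le_iff_le_comap.mp ?_)
  refine le_sSup ⟨hN.map _ φ.surjective, ?_, fun K hK hKN => ?_⟩
  · rwa [Ne, map_eq_bot_iff_of_injective _ φ.injective]
  · have hcomap : (K.comap φ.toMonoidHom).map φ.toMonoidHom = K :=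
      map_comap_eq_self_of_surjective φ.surjective K
    have hle : K.comap φ.toMonoidHom ≤ N := by
      rw [← comap_map_eq_self_of_injective (f := φ.toMonoidHom) φ.injective N]
      exact comap_mono hKN
    rcases hmin _ (hK.comap _) hle with h | h
    · left; rw [← hcomap, h, Subgroup.map_bot]
    · right; rw [← hcomap, h]

theorem subsingleton_of_socle_eq_bot [Finite G] (h : socle G = ⊥) : Subsingleton G := by
  by_contra hG
  rw [not_subsingleton_iff_nontrivial] at hG
  obtain ⟨N, hN⟩ := (Set.toFinite {N : Subgroup G | N.Normal ∧ N ≠ ⊥}).exists_minimal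
    ⟨⊤, inferInstance, top_ne_bot⟩
  have hmin : IsMinimalNormal N := by
    refine ⟨hN.prop.1, hN.prop.2, fun K hK hKN => ?_⟩
    by_cases hK' : K = ⊥
    · exact Or.inl hK'
    · exact Or.inr (hN.eq_of_le ⟨hK, hK'⟩ hKN)
  exact hN.prop.2 (le_bot_iff.mp (h ▸ le_sSup hmin))

instance quasinilpotentRadical_normal : (quasinilpotentRadical G).Normal := by
  have : (fittingCentralizerQuotient G).Normal :=
    Normal.map inferInstance _ (QuotientGroup.mk'_surjective _)
  have := socle_characteristic (G := fittingCentralizerQuotient G)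
  exact Normal.comap inferInstance _

theorem fittingSubgroup_le_quasinilpotentRadical :
    fittingSubgroup G ≤ quasinilpotentRadical G := by
  intro x hx
  have : (QuotientGroup.mk' (fittingSubgroup G)) x = 1 := (QuotientGroup.eq_one_iff x).mpr hx
  rw [quasinilpotentRadical, mem_comap, this]
  exact one_mem _

theorem quasinilpotentRadical_le :
    quasinilpotentRadical G ≤ centralizer (fittingSubgroup G : Set G) ⊔ fittingSubgroup G := by
  refine (comap_mono (map_subtype_le _)).trans ?_
  rw [fittingCentralizerQuotient, comap_map_eq, QuotientGroup.ker_mk', sup_assoc, sup_idem]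

/-- If `F^*(G) / F(G)` is abelian, then `F^*(G) = F(G)`: the intersection of `F^*(G)` with
`C_G(F(G))` is then nilpotent of class at most two. -/
theorem quasinilpotentRadical_le_fittingSubgroup
    (h : ⁅quasinilpotentRadical G, quasinilpotentRadical G⁆ ≤ fittingSubgroup G) :
    quasinilpotentRadical G ≤ fittingSubgroup G := by
  set D := centralizer (fittingSubgroup G : Set G) ⊓ quasinilpotentRadical G
  have hnil : Group.IsNilpotent D := by
    refine isNilpotent_of_lowerCentralSeries_eq_bot (n := 2) ?_
    change ⁅⁅D, D⁆, D⁆ = ⊥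
    rw [commutator_eq_bot_iff_le_centralizer]
    have h1 : ⁅D, D⁆ ≤ fittingSubgroup G := (commutator_mono inf_le_right inf_le_right).trans h
    exact h1.trans (le_centralizer_iff.mp inf_le_left)
  have hDF : D ≤ fittingSubgroup G := le_sSup ⟨inferInstance, hnil⟩
  intro r hr
  obtain ⟨c, hc, f, hf, rfl⟩ := mem_sup_of_normal_right.mp (quasinilpotentRadical_le hr)
  refine mul_mem (hDF ⟨hc, ?_⟩) hf
  exact (mul_mem_cancel_right (fittingSubgroup_le_quasinilpotentRadical hf)).mp hr

/-- If `F^*(G) = F(G)`, then `C_G(F(G)) F(G) / F(G)` has trivial socle, so it is trivial. -/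
theorem centralizer_fittingSubgroup_le [Finite G]
    (h : quasinilpotentRadical G ≤ fittingSubgroup G) :
    centralizer (fittingSubgroup G : Set G) ≤ fittingSubgroup G := by
  have hsoc : socle (fittingCentralizerQuotient G) = ⊥ := by
    rw [← map_eq_bot_iff_of_injective _ (fittingCentralizerQuotient G).subtype_injective,
      eq_bot_iff]
    intro y hy
    obtain ⟨x, rfl⟩ := QuotientGroup.mk'_surjective _ y
    exact (QuotientGroup.eq_one_iff x).mpr (h hy)
  have hbot : fittingCentralizerQuotient G = ⊥ := by
    have := subsingleton_of_socle_eq_bot hsoc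
    exact eq_bot_of_subsingleton _
  rw [fittingCentralizerQuotient, Subgroup.map_eq_bot_iff, QuotientGroup.ker_mk'] at hbot
  exact le_sup_left.trans hbot

/-- If `x` generates an `R`-subnormal `p`-subgroup, with `R` normal, then `[x, R]` lies in
`O_p(G)`: it lies in the intersection of `O_p(⟨x, R⟩)` with `R`, which is a subnormal
`p`-subgroup of `G`. -/
theorem commutator_mem_pCore [Finite G] {p : ℕ} {R : Subgroup G} [R.Normal] {x r : G}
    (hx : IsPGroup p (zpowers x)) (hxR : IsRelSubnormal R (zpowers x)) (hr : r ∈ R) :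
    ⁅x, r⁆ ∈ pCore p G := by
  set L := zpowers x ⊔ R
  have hxL : x ∈ L := le_sup_left (a := zpowers x) (mem_zpowers x)
  have hRL : R ≤ L := le_sup_right
  set T := (pCore p L).map L.subtype
  have hxT : x ∈ T :=
    ⟨⟨x, hxL⟩, le_pCore_of_isSubnormal hxR hx.comap_subtype (mem_zpowers x), rfl⟩
  have hconj : ∀ t ∈ T, ∀ l ∈ L, l * t * l⁻¹ ∈ T := by
    rintro _ ⟨t, ht, rfl⟩ l hl
    exact ⟨⟨l, hl⟩ * t * ⟨l, hl⟩⁻¹, Normal.conj_mem inferInstance t ht _, rfl⟩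
  have hsub : (T ⊓ R).IsSubnormal := by
    refine .step _ R inf_le_right (Normal.isSubnormal inferInstance) ⟨fun t ht l => ?_⟩
    exact ⟨hconj _ ht.1 _ (hRL l.2), Normal.conj_mem inferInstance _ ht.2 _⟩
  have hpT : IsPGroup p T := isPGroup_pCore.map _
  refine le_pCore_of_isSubnormal hsub (hpT.to_le inf_le_left) ⟨?_, ?_⟩
  · rw [commutatorElement_def, mul_assoc, mul_assoc, ← mul_assoc r]
    exact mul_mem hxT (hconj _ (inv_mem hxT) _ (hRL hr))
  · exact R.mul_mem (Normal.conj_mem inferInstance _ hr _) (R.inv_mem hr)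

end Finite

/-! ### Nilpotency from subnormality of cyclic primary subgroups -/

section Main

variable {G : Type*} [Group G] [Finite G]

/-- If every element of prime power order satisfies `[x, F^*(G)] ≤ O_p(G)`, then
`F^*(G) / F(G)` is central in `G / F(G)`, which forces `C_G(F(G)) ≤ F(G)`. -/
theorem centralizer_fittingSubgroup_le_of_commutator_mem_pCore
    (h : ∀ p : ℕ, p.Prime → ∀ x : G, IsPGroup p (zpowers x) →
      ∀ r ∈ quasinilpotentRadical G, ⁅x, r⁆ ∈ pCore p G) :
    centralizer (fittingSubgroup G : Set G) ≤ fittingSubgroup G := by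
  set π := QuotientGroup.mk' (fittingSubgroup G)
  have htop : (centralizer ((quasinilpotentRadical G).map π : Set (G ⧸ fittingSubgroup G))).comap π
      = ⊤ := by
    refine eq_top_of_forall_exists_sylow_le fun p hp => ?_
    obtain ⟨P⟩ : Nonempty (Sylow p G) := inferInstance
    refine ⟨P, fun x hx => ?_⟩
    rw [mem_comap, mem_centralizer_iff_commutator_eq_one]
    rintro _ ⟨r, hr, rfl⟩
    rw [← inv_eq_one, commutatorElement_inv, ← map_commutatorElement]
    refine (QuotientGroup.eq_one_iff _).mpr (pCore_le_fittingSubgroup hp (h p hp x ?_ r hr))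
    exact P.isPGroup'.to_le (zpowers_le.mpr hx)
  refine centralizer_fittingSubgroup_le (quasinilpotentRadical_le_fittingSubgroup ?_)
  rw [commutator_le]
  intro a ha b hb
  have hb' : b ∈ (⊤ : Subgroup G) := mem_top b
  rw [← htop, mem_comap, mem_centralizer_iff_commutator_eq_one] at hb'
  have := hb' (π a) (mem_map_of_mem π ha)
  rw [← map_commutatorElement] at this
  exact (QuotientGroup.eq_one_iff _).mp this

/-- If an element of `p`-power order centralizes `O_r(G)` whenever `r ≠ p`, then commutators of
elements of coprime prime power orders centralize every `O_r(G)`, hence `F(G)`. -/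
theorem commutator_mem_centralizer_fittingSubgroup {p q : ℕ} (hpq : p ≠ q) {x y : G}
    (hx : ∀ r : ℕ, r.Prime → r ≠ p → x ∈ centralizer (pCore r G : Set G))
    (hy : ∀ r : ℕ, r.Prime → r ≠ q → y ∈ centralizer (pCore r G : Set G)) :
    ⁅y, x⁆ ∈ centralizer (fittingSubgroup G : Set G) := by
  rw [← zpowers_le, le_centralizer_iff, fittingSubgroup_eq_iSup_pCore]
  refine iSup_le fun ⟨r, hr⟩ => ?_
  rw [← le_centralizer_iff, zpowers_le]
  by_cases hrp : r = p
  · have hyr := hy r hr (hrp ▸ hpq)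
    rw [commutatorElement_def, mul_assoc, mul_assoc, ← mul_assoc x]
    exact mul_mem hyr (Normal.conj_mem inferInstance _ (inv_mem hyr) _)
  · have hxr := hx r hr hrp
    exact mul_mem (Normal.conj_mem inferInstance _ hxr _) (inv_mem hxr)

/-- `P F(G)` is normal in `G`, as `F(G)` contains the commutators of `P` with Sylow subgroups for
the other primes; `P` is normal in `P F(G)`, as it is centralized by the other primary parts of
`F(G)`. The Frattini argument then yields normality of `P` in `G`. -/
theorem sylow_normal_of_mem_centralizer_pCore
    (hF : centralizer (fittingSubgroup G : Set G) ≤ fittingSubgroup G)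
    (h : ∀ p : ℕ, p.Prime → ∀ x : G, IsPGroup p (zpowers x) →
      ∀ r : ℕ, r.Prime → r ≠ p → x ∈ centralizer (pCore r G : Set G))
    {p : ℕ} [Fact p.Prime] (P : Sylow p G) : (P : Subgroup G).Normal := by
  have hS : ∀ q : ℕ, q.Prime → ∀ Q : Sylow q G, ∀ y ∈ Q,
      ∀ r : ℕ, r.Prime → r ≠ q → y ∈ centralizer (pCore r G : Set G) :=
    fun q hq Q y hy => h q hq y (Q.isPGroup'.to_le (zpowers_le.mpr hy))
  set π := QuotientGroup.mk' (fittingSubgroup G)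
  have htop : (normalizer ((P : Subgroup G).map π : Set (G ⧸ fittingSubgroup G))).comap π = ⊤ := by
    refine eq_top_of_forall_exists_sylow_le fun q hq => ?_
    by_cases hpq : p = q
    · subst hpq
      exact ⟨P, map_le_iff_le_comap.mp le_normalizer⟩
    · obtain ⟨Q⟩ : Nonempty (Sylow q G) := inferInstance
      refine ⟨Q, fun y hy => centralizer_le_normalizer _ ?_⟩
      rw [mem_centralizer_iff_commutator_eq_one]
      rintro _ ⟨x, hx, rfl⟩
      rw [← map_commutatorElement]
      refine (QuotientGroup.eq_one_iff _).mpr (hF ?_)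
      exact commutator_mem_centralizer_fittingSubgroup (Ne.symm hpq) (hS q hq Q y hy)
        (hS p Fact.out P x hx)
  have hN : ((P : Subgroup G) ⊔ fittingSubgroup G).Normal := by
    have hn : ((P : Subgroup G).map π).Normal := by
      rw [← normalizer_eq_top_iff, eq_top_iff,
        ← map_top_of_surjective π (QuotientGroup.mk'_surjective _), map_le_iff_le_comap, htop]
    have := hn.comap π
    rwa [comap_map_eq, QuotientGroup.ker_mk'] at this
  have hFP : fittingSubgroup G ≤ normalizer (P : Set G) := by
    rw [fittingSubgroup_eq_iSup_pCore]
    refine iSup_le fun ⟨r, hr⟩ => ?_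
    by_cases hrp : r = p
    · subst hrp
      exact (isPGroup_pCore.le_sylow_of_normal P).trans le_normalizer
    · refine le_trans ?_ (centralizer_le_normalizer _)
      exact le_centralizer_iff.mp fun x hx => hS p Fact.out P x hx r hr hrp
  rw [← normalizer_eq_top_iff, ← P.normalizer_sup_eq_top' (le_sup_left (b := fittingSubgroup G)),
    P.coe_coe, eq_comm, sup_eq_left]
  exact sup_le le_normalizer hFP

/-- The cyclic case suffices because only elements of prime power order, and not whole Sylow
subgroups, enter the commutator conditions above. -/
theorem isNilpotent_of_isRelSubnormal
    (h : ∀ p : ℕ, p.Prime → ∀ H : Subgroup G, IsCyclic H → IsPGroup p H →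
      IsRelSubnormal (quasinilpotentRadical G) H) : Group.IsNilpotent G := by
  have hcomm : ∀ p : ℕ, p.Prime → ∀ x : G, IsPGroup p (zpowers x) →
      ∀ r ∈ quasinilpotentRadical G, ⁅x, r⁆ ∈ pCore p G :=
    fun p hp x hx r hr => commutator_mem_pCore hx (h p hp _ inferInstance hx) hr
  refine (Group.isNilpotent_of_finite_tfae.out 0 3 rfl rfl).mpr fun p hp P => ?_
  refine sylow_normal_of_mem_centralizer_pCore
    (centralizer_fittingSubgroup_le_of_commutator_mem_pCore hcomm) ?_ P
  intro p hp x hx r hr hrp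
  rw [mem_centralizer_iff_commutator_eq_one]
  intro f hf
  have := Fact.mk hp
  have := Fact.mk hr
  -- `[x, f]` lies in both `O_p(G)` and `O_r(G)`, which intersect trivially.
  have h1 : ⁅x, f⁆ ∈ pCore p G := hcomm p hp x hx f
    (fittingSubgroup_le_quasinilpotentRadical (pCore_le_fittingSubgroup hr hf))
  have h2 : ⁅x, f⁆ ∈ pCore r G :=
    mul_mem (Normal.conj_mem inferInstance _ hf _) (inv_mem hf)
  rw [← inv_eq_one, commutatorElement_inv]
  exact disjoint_def.mp
    (IsPGroup.disjoint_of_ne p r (Ne.symm hrp) _ _ isPGroup_pCore isPGroup_pCore) h1 h2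

end Main

end FiniteGroupTheory

open FiniteGroupTheory in
theorem theorem4p3 (G : Type*) [Group G] [Finite G] :
    List.TFAE [
      Group.IsNilpotent G,
      ∀ H : Subgroup G, FiniteGroupTheory.IsAbnormal H →
        FiniteGroupTheory.IsRelSubnormal (FiniteGroupTheory.quasinilpotentRadical G) H,
      ∀ (p : ℕ), p.Prime → ∀ P : Sylow p G,
        FiniteGroupTheory.IsRelSubnormal (FiniteGroupTheory.quasinilpotentRadical G)
          (Subgroup.normalizer (P : Set G)),
      ∀ (p : ℕ), p.Prime → ∀ H : Subgroup G, IsCyclic H → IsPGroup p H →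
        FiniteGroupTheory.IsRelSubnormal (FiniteGroupTheory.quasinilpotentRadical G) H,
      ∀ (p : ℕ), p.Prime → ∀ P : Sylow p G,
        FiniteGroupTheory.IsRelSubnormal (FiniteGroupTheory.quasinilpotentRadical G)
          (P : Subgroup G)] := by
  tfae_have 1 → 2 := fun _ H _ => (isSubnormal_of_isNilpotent H).subgroupOf
  tfae_have 2 → 3 := fun h p hp P => by
    have := Fact.mk hp
    exact h _ (isAbnormal_normalizer_sylow P)
  tfae_have 3 → 5 := fun h p hp P =>
    (h p hp P).of_isSubnormal_subgroupOf le_normalizer normal_in_normalizer.isSubnormal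
  tfae_have 5 → 4 := fun h p hp H _ hH => by
    obtain ⟨P, hHP⟩ := hH.exists_le_sylow
    have := Fact.mk hp
    have : Group.IsNilpotent P := P.isPGroup'.isNilpotent
    exact (h p hp P).of_isSubnormal_subgroupOf hHP (isSubnormal_of_isNilpotent _)
  tfae_have 4 → 1 := isNilpotent_of_isRelSubnormal
  tfae_finish
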